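/- Let $k$ be a field. An Akivis algebra over $k$ is a $k$-vector space $A$ with a skew-symmetric bilinear product $[x,y]$ (meaning $[x,x]=0$ for all $x$, which is equivalent to $[x,y]=-[y,x]$ if $\operatorname{char} k\neq 2$) and a trilinear product $(x,y,z)$ such that $$[[x,y],z]+[[y,z],x]+[[z,x],y]=(x,y,z)+(z,x,y)+(y,z,x)-(x,z,y)-(y,x,z)-(z,y,x).$$ Let $A$ be an Akivis algebra with a basis $\{e_i\mid i\in I\}$ indexed by a linearly ordered set $I$. Let $M(X)$ be the free (non-unital) non-associative $k$-algebra on letters $X=\{e_i\mid i\in I\}$; its basis is the set $X^{**}$ of non-associative words. For $a=\sum_m c_m e_m\in A$ regard $\sum_m c_m e_m$ also as a linear polynomial in $M(X)$, and write $\{e_ie_j\}$ and $\{e_ie_je_k\}$ for the linear polynomials of $[e_i,e_j]$ and $(e_i,e_j,e_k)$. The universal enveloping algebra of $A$ is the non-associative algebra with generators and relations $$U(A)=M\bigl(\{e_i\}_I\bigm| e_ie_j-e_je_i=\{e_ie_j\},\ (e_ie_j)e_k-e_i(e_je_k)=\{e_ie_je_k\},\ i,j,k\in I\bigr).$$ Order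 $X^{**}$ by deg-lex: letters are ordered as $I$; a longer word is greater; and if $u=u_1u_2$ and $v=v_1v_2$ have the same length, then $u>v$ iff $u_1>v_1$, or $u_1=v_1$ and $u_2>v_2$. Let $\bar f$ be the greatest word occurring in $f\neq 0$; $f$ is monic if the coefficient of $\bar f$ in $f$ is $1$. For a set $S\subset M(X)$ of monic polynomials, an $S$-word is an expression $(asb)$ obtained from some $s\in S$ by successively multiplying on the left or right by words; $(a\bar sb)$ denotes the word obtained by putting $\bar s$ in place of $s$. The set $S$ is a Gröbner–Shirshov basis in $M(X)$ if, whenever $f,g\in S$ and $\bar f=(a\bar gb)$, the composition $f-(agb)$ is a linear combination of $S$-words $(a_is_ib_i)$ with $(a_i\bar s_ib_i)<\bar f$ (the empty set is counted as a Gröbner–Shirshov basis). It is a Gröbner–Shirshov basis for $U(A)$ if moreover it generates the same ideal of $M(X)$ as the defining relations of $U(A)$. Let $S$ be the set of the polynomials $$f_{ij}=e_ie_j-e_je_i-\{e_ie_j\}\quad(i>j),\qquad g_{ijk}=(e_ie_j)e_k-e_i(e_je_k)-\{e_ie_je_k\}\quad(i,j,k\in I),$$ $$h_{ijk}=e_i(e_je_k)-e_j(e_ie_k)-\{e_ie_j\}e_k-\{e_je_ie_k\}+\{e_ie_je_k\}\quad(i>j,\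 k\ge j).$$ Then: (i) $S$ is a Gröbner–Shirshov basis for $U(A)$. (ii) $A$ embeds into $U(A)$: the canonical linear map $A\to U(A)$, $e_i\mapsto e_i$, is injective, and it carries $[x,y]$ to the commutator $xy-yx$ and $(x,y,z)$ to the associator $(xy)z-x(yz)$. Thus every Akivis algebra is linear (Shestakov's theorem). -/

import Mathlib

/-- An Akivis algebra over `k`: a vector space with a skew-symmetric bilinear product `[x, y]` and a
trilinear product `(x, y, z)` satisfying the Akivis identity. Skew-symmetry is stated in the form
`[x, x] = 0`, which is equivalent to `[x, y] = -[y, x]` in characteristic different from two. -/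
class AkivisAlgebra (k A : Type*) [Field k] [AddCommGroup A] [Module k A] where
  /-- the binary product `[x, y]` -/
  br : A →ₗ[k] A →ₗ[k] A
  /-- the ternary product `(x, y, z)` -/
  tri : A →ₗ[k] A →ₗ[k] A →ₗ[k] A
  br_self : ∀ x : A, br x x = 0
  akivis : ∀ x y z : A,
    br (br x y) z + br (br y z) x + br (br z x) y =
      tri x y z + tri z x y + tri y z x - tri x z y - tri y x z - tri z y x

namespace NonAssoc

/-! ### Ideals and presentations of non-associative algebras -/

section Ideal

variable (k : Type*) [Field k] {B : Type*} [NonUnitalNonAssocRing B] [Module k B]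

/-- The ideal `Id(S)` generated by `S`: the smallest subspace that contains `S` and is closed under
left and right multiplication by arbitrary elements. -/
def idealSpan (S : Set B) : Submodule k B :=
  sInf {J : Submodule k B | S ⊆ J ∧ ∀ x ∈ J, ∀ y : B, y * x ∈ J ∧ x * y ∈ J}

variable {k}

theorem idealSpan_mul_mem (S : Set B) {x : B} (hx : x ∈ idealSpan k S) (y : B) :
    y * x ∈ idealSpan k S ∧ x * y ∈ idealSpan k S := by
  simp only [idealSpan, Submodule.mem_sInf, Set.mem_ofPred_eq] at hx ⊢
  exact ⟨fun J hJ => (hJ.2 x (hx J hJ) y).1, fun J hJ => (hJ.2 x (hx J hJ) y).2⟩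

variable (k)

/-- The quotient algebra `B / Id(S)`. -/
def QuotAlg (S : Set B) : Type _ := B ⧸ idealSpan k S

namespace QuotAlg

variable {k} (S : Set B)

instance : AddCommGroup (QuotAlg k S) := inferInstanceAs (AddCommGroup (B ⧸ idealSpan k S))

instance : Module k (QuotAlg k S) := inferInstanceAs (Module k (B ⧸ idealSpan k S))

/-- The canonical projection `B → B / Id(S)`. -/
def mk : B →ₗ[k] QuotAlg k S := (idealSpan k S).mkQ

theorem mk_surjective : Function.Surjective (mk (k := k) S) := Submodule.mkQ_surjective _

theorem mk_eq_mk {x y : B} : mk (k := k) S x = mk S y ↔ x - y ∈ idealSpan k S :=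
  Submodule.Quotient.eq _

instance : Mul (QuotAlg k S) where
  mul := Quotient.map₂ (fun x y : B => x * y) (by
    intro a a' ha b b' hb
    have ha' := (Submodule.quotientRel_def _).1 ha
    have hb' := (Submodule.quotientRel_def _).1 hb
    refine (Submodule.quotientRel_def _).2 ?_
    have e : a * b - a' * b' = (a - a') * b + a' * (b - b') := by
      rw [sub_mul, mul_sub]; abel
    rw [e]
    exact add_mem (idealSpan_mul_mem S ha' b).2 (idealSpan_mul_mem S hb' a').1)

theorem mk_mul (x y : B) : mk (k := k) S (x * y) = mk S x * mk S y := rfl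

instance : NonUnitalNonAssocRing (QuotAlg k S) :=
  { (inferInstance : AddCommGroup (QuotAlg k S)), (inferInstance : Mul (QuotAlg k S)) with
    left_distrib := fun a b c => by
      obtain ⟨a, rfl⟩ := mk_surjective (k := k) S a
      obtain ⟨b, rfl⟩ := mk_surjective (k := k) S b
      obtain ⟨c, rfl⟩ := mk_surjective (k := k) S c
      simp only [← map_add, ← mk_mul, mul_add]
    right_distrib := fun a b c => by
      obtain ⟨a, rfl⟩ := mk_surjective (k := k) S a
      obtain ⟨b, rfl⟩ := mk_surjective (k := k) S b
      obtain ⟨c, rfl⟩ := mk_surjective (k := k) S c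
      simp only [← map_add, ← mk_mul, add_mul]
    zero_mul := fun a => by
      obtain ⟨a, rfl⟩ := mk_surjective (k := k) S a
      rw [← map_zero (mk (k := k) S), ← mk_mul, zero_mul]
    mul_zero := fun a => by
      obtain ⟨a, rfl⟩ := mk_surjective (k := k) S a
      rw [← map_zero (mk (k := k) S), ← mk_mul, mul_zero] }

instance [IsScalarTower k B B] : IsScalarTower k (QuotAlg k S) (QuotAlg k S) where
  smul_assoc c x y := by
    obtain ⟨x, rfl⟩ := mk_surjective (k := k) S x
    obtain ⟨y, rfl⟩ := mk_surjective (k := k) S y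
    simp only [smul_eq_mul]
    rw [← map_smul, ← mk_mul, ← mk_mul, ← map_smul, smul_mul_assoc]

instance [SMulCommClass k B B] : SMulCommClass k (QuotAlg k S) (QuotAlg k S) where
  smul_comm c x y := by
    obtain ⟨x, rfl⟩ := mk_surjective (k := k) S x
    obtain ⟨y, rfl⟩ := mk_surjective (k := k) S y
    simp only [smul_eq_mul]
    rw [← map_smul, ← mk_mul, ← mk_mul, ← map_smul, mul_smul_comm]

end QuotAlg

end Ideal

/-! ### Words, the deg-lex order, leading words

The set `X**` of non-associative words is `FreeMagma X`, and the free non-associative algebra `M(X)`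
is `FreeNonUnitalNonAssocAlgebra k X`, the space of finite linear combinations of words. -/

/-- `WordLT u v` means `u < v` in the deg-lex order: letters are compared by the order of the
alphabet; otherwise shorter words are smaller, and words `u₁ * u₂`, `v₁ * v₂` of the same length are
compared lexicographically, first `u₁` with `v₁`, then `u₂` with `v₂`. -/
def WordLT {X : Type*} [LinearOrder X] : FreeMagma X → FreeMagma X → Prop
  | .of x, .of y => x < y
  | .of _, .mul _ _ => True
  | .mul _ _, .of _ => False
  | .mul u₁ u₂, .mul v₁ v₂ =>
      (u₁ * u₂).length < (v₁ * v₂).length ∨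
        ((u₁ * u₂).length = (v₁ * v₂).length ∧ (WordLT u₁ v₁ ∨ (u₁ = v₁ ∧ WordLT u₂ v₂)))

/-- Words with one hole, that is, pairs `(a, b)` such that `(a · b)` is a bracketed word once the dot
is replaced by a word. -/
inductive WordCtx (X : Type*) : Type _
  | hole : WordCtx X
  | mulRight : WordCtx X → FreeMagma X → WordCtx X
  | mulLeft : FreeMagma X → WordCtx X → WordCtx X

namespace WordCtx

variable {X : Type*}

/-- The word `(a u b)`. -/
def fillWord : WordCtx X → FreeMagma X → FreeMagma X
  | hole, u => u
  | mulRight c v, u => c.fillWord u * v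
  | mulLeft v c, u => v * c.fillWord u

/-- The polynomial `(a s b)`; for `s ∈ S` these are the `S`-words. -/
noncomputable def fillPoly {k : Type*} [Field k] :
    WordCtx X → FreeNonUnitalNonAssocAlgebra k X → FreeNonUnitalNonAssocAlgebra k X
  | hole, s => s
  | mulRight c v, s => c.fillPoly s * MonoidAlgebra.ofMagma k (FreeMagma X) v
  | mulLeft v c, s => MonoidAlgebra.ofMagma k (FreeMagma X) v * c.fillPoly s

end WordCtx

section GroebnerShirshov

variable {k X : Type*} [Field k] [LinearOrder X]

/-- `w` is the leading word of `f`: the deg-lex largest word occurring in `f`. -/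
def IsLeadingWord (f : FreeNonUnitalNonAssocAlgebra k X) (w : FreeMagma X) : Prop :=
  w ∈ f.coeff.support ∧ ∀ u ∈ f.coeff.support, u ≠ w → WordLT u w

/-- `f` is monic: it has a leading word, and the coefficient of that word is `1`. -/
def IsMonic (f : FreeNonUnitalNonAssocAlgebra k X) : Prop :=
  ∃ w, IsLeadingWord f w ∧ f.coeff w = 1

/-- `p ≡ 0 mod (S, w)`: `p` is a linear combination of `S`-words `(a s b)`, `s ∈ S`, such that the
word `(a s̄ b)` is smaller than `w`, where `s̄` is the leading word of `s`. -/
def TrivialMod (S : Set (FreeNonUnitalNonAssocAlgebra k X)) (w : FreeMagma X)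
    (p : FreeNonUnitalNonAssocAlgebra k X) : Prop :=
  p ∈ Submodule.span k {q | ∃ s ∈ S, ∃ (v : FreeMagma X) (c : WordCtx X),
    IsLeadingWord s v ∧ WordLT (c.fillWord v) w ∧ q = c.fillPoly s}

/-- `S` is a Gröbner–Shirshov basis in `M(X)`: it consists of monic polynomials, and for `f, g ∈ S`
with leading words `f̄ = (a ḡ b)` the composition of inclusion `f - (a g b)` is trivial modulo
`(S, f̄)`. -/
def IsGroebnerShirshovBasis (S : Set (FreeNonUnitalNonAssocAlgebra k X)) : Prop :=
  (∀ s ∈ S, IsMonic s) ∧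
    ∀ f ∈ S, ∀ g ∈ S, ∀ (u v : FreeMagma X) (c : WordCtx X),
      IsLeadingWord f u → IsLeadingWord g v → u = c.fillWord v →
        TrivialMod S u (f - c.fillPoly g)

end GroebnerShirshov

end NonAssoc

/-! ### The universal enveloping algebra of an Akivis algebra -/

namespace AkivisAlgebra

open NonAssoc

variable {k A I : Type*} [Field k] [AddCommGroup A] [Module k A] [AkivisAlgebra k A]

/-- The letter `e_i` of the free non-associative algebra `M({e_i})`. -/
noncomputable def letter (k : Type*) [Field k] {I : Type*} (i : I) :
    FreeNonUnitalNonAssocAlgebra k I :=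
  FreeNonUnitalNonAssocAlgebra.of k i

/-- The linear polynomial `∑ cₘ eₘ` in `M({e_i})` of an element `∑ cₘ eₘ` of `A`. -/
noncomputable def lin (e : Module.Basis I k A) : A →ₗ[k] FreeNonUnitalNonAssocAlgebra k I :=
  e.constr k (letter k)

/-- `f_{ij} = e_i e_j - e_j e_i - {e_i e_j}`, with `{e_i e_j} = [e_i, e_j]` as a linear polynomial -/
noncomputable def fPoly (e : Module.Basis I k A) (i j : I) : FreeNonUnitalNonAssocAlgebra k I :=
  letter k i * letter k j - letter k j * letter k i - lin e (br (k := k) (e i) (e j))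

/-- `g_{ijk} = (e_i e_j) e_k - e_i (e_j e_k) - {e_i e_j e_k}`, where `{e_i e_j e_k}` is the ternary
product `(e_i, e_j, e_k)` as a linear polynomial -/
noncomputable def gPoly (e : Module.Basis I k A) (i j l : I) : FreeNonUnitalNonAssocAlgebra k I :=
  (letter k i * letter k j) * letter k l - letter k i * (letter k j * letter k l)
    - lin e (tri (k := k) (e i) (e j) (e l))

/-- `h_{ijk} = e_i (e_j e_k) - e_j (e_i e_k) - {e_i e_j} e_k - {e_j e_i e_k} + {e_i e_j e_k}` -/
noncomputable def hPoly (e : Module.Basis I k A) (i j l : I) : FreeNonUnitalNonAssocAlgebra k I :=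
  letter k i * (letter k j * letter k l) - letter k j * (letter k i * letter k l)
    - lin e (br (k := k) (e i) (e j)) * letter k l
    - lin e (tri (k := k) (e j) (e i) (e l)) + lin e (tri (k := k) (e i) (e j) (e l))

/-- The defining relations of `U(A)`: `e_i e_j - e_j e_i = [e_i, e_j]` and
`(e_i e_j) e_k - e_i (e_j e_k) = (e_i, e_j, e_k)` for all `i, j, k`. -/
def relations (e : Module.Basis I k A) : Set (FreeNonUnitalNonAssocAlgebra k I) :=
  {p | ∃ i j, p = fPoly e i j} ∪ {p | ∃ i j l, p = gPoly e i j l}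

/-- The universal enveloping algebra `U(A)`, given by generators `e_i` and the defining relations. -/
abbrev UEnv (e : Module.Basis I k A) : Type _ := QuotAlg k (relations e)

/-- The canonical linear map `A → U(A)`, `e_i ↦ e_i`. -/
noncomputable def ι (e : Module.Basis I k A) : A →ₗ[k] UEnv e :=
  e.constr k fun i => QuotAlg.mk (relations e) (letter k i)

/-- The set `S` of all `f_{ij}` with `i > j`, all `g_{ijk}`, and all `h_{ijk}` with `i > j` and
`k ≥ j`. -/
def gsSet [LinearOrder I] (e : Module.Basis I k A) : Set (FreeNonUnitalNonAssocAlgebra k I) :=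
  {p | ∃ i j, i > j ∧ p = fPoly e i j} ∪ {p | ∃ i j l, p = gPoly e i j l} ∪
    {p | ∃ i j l, i > j ∧ l ≥ j ∧ p = hPoly e i j l}

end AkivisAlgebra

/-! The leading words are `e_i e_j` (`i > j`), `(e_i e_j) e_l` and `e_i (e_j e_l)` (`i > j`, `l ≥
j`). Apart from a polynomial with itself, the only inclusion is `e_i e_j` in `(e_i e_j) e_l`, with
composition `g_{jil} - h_{ijl}`. If `l ≥ j`, both terms lie in `S` and have smaller leading words.
If `l < j < i`, `hPoly_eq` writes `h_{ijl}` through `h_{ilj}`, `h_{jli}` and multiples of the `f`'s;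
its linear part is exactly the Akivis identity.

The embedding is proved independently of the Gröbner–Shirshov property, through a model: `U(A)`
truncated to its normal words of length at most two, that is `A ⊕ S²A`. Its product reduces by the
`f`, `g`, `h` rules and sets normal words of length three to zero. The relations only involve
products with a factor in `A`, so two quadratic elements may be given product zero. The Akivis
identity makes the reductions consistent (`leftAssoc_basis_sub_swap`), and then `quadMul_quadMul`
says that the associator on `A` is the ternary product. Hence `M(X)` maps onto generators of this
model with the relations in the kernel, and `A` stays injective. -/

namespace AkivisAlgebra

open NonAssoc

/-! ### Skew-symmetry and identities checked on a basis -/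

section Basic

variable {k A : Type*} [Field k] [AddCommGroup A] [Module k A] [AkivisAlgebra k A]

theorem br_swap (x y : A) : br (k := k) y x = -br (k := k) x y := by
  have h := br_self (k := k) (x + y)
  simp only [map_add, LinearMap.add_apply, br_self, zero_add, add_zero] at h
  exact eq_neg_of_add_eq_zero_left h

omit [AkivisAlgebra k A] in
theorem sub_swap_ext {I B : Type*} [AddCommGroup B] [Module k B] (e : Module.Basis I k A)
    (F G : A →ₗ[k] A →ₗ[k] B) (h : ∀ i j, F (e i) (e j) - F (e j) (e i) = G (e i) (e j))
    (x y : A) : F x y - F y x = G x y := by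
  have h : F - F.flip = G := e.ext fun i => e.ext fun j => h i j
  exact congr($h x y)

omit [AkivisAlgebra k A] in
theorem sub_swap_ext₃ {I B : Type*} [AddCommGroup B] [Module k B] (e : Module.Basis I k A)
    (F G : A →ₗ[k] A →ₗ[k] A →ₗ[k] B)
    (h : ∀ i j l, F (e i) (e j) (e l) - F (e j) (e i) (e l) = G (e i) (e j) (e l))
    (x y z : A) : F x y z - F y x z = G x y z :=
  congr($(sub_swap_ext e F G (fun i j => e.ext fun l => h i j l) x y) z)

end Basic

/-! ### The model algebra `A ⊕ S²A` -/

section Model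

variable {k A I : Type*} [Field k] [AddCommGroup A] [Module k A] [AkivisAlgebra k A]
  [LinearOrder I] (e : Module.Basis I k A)

/-- The space `A ⊕ S²A`, the underlying space of an algebra in which `A` embeds. The symmetric
square is realised on the symbols `(i, j)`, of which those with `i ≤ j` matter. -/
abbrev QuadSpace (k A I : Type*) [Field k] [AddCommGroup A] [Module k A] : Type _ :=
  A × (I × I →₀ k)

/-- The product of two elements of `A`. -/
noncomputable def quadMul : A →ₗ[k] A →ₗ[k] QuadSpace k A I :=
  e.constr k fun i => e.constr k fun j =>
    if i ≤ j then (0, .single (i, j) 1) else (br (k := k) (e i) (e j), .single (j, i) 1)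

theorem quadMul_basis_of_le {i j : I} (h : i ≤ j) :
    quadMul e (e i) (e j) = (0, .single (i, j) 1) := by
  simp [quadMul, h]

theorem quadMul_basis_of_lt {i j : I} (h : j < i) :
    quadMul e (e i) (e j) = (br (k := k) (e i) (e j), .single (j, i) 1) := by
  simp [quadMul, h.not_ge]

/-- On basis vectors both products carry the same symbol, which cancels; only the bracket remains.
-/
theorem quadMul_sub_swap (x y : A) :
    quadMul e x y - quadMul e y x = (br (k := k) x y, 0) := by
  refine sub_swap_ext e (quadMul e)
    ((br (k := k) (A := A)).compr₂ (LinearMap.inl k A (I × I →₀ k))) (fun i j => ?_) x y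
  rcases lt_trichotomy i j with h | rfl | h
  · simp [quadMul_basis_of_le e h.le, quadMul_basis_of_lt e h, br_swap (e j) (e i)]
  · simp [br_self, ← Prod.zero_eq_mk]
  · simp [quadMul_basis_of_le e h.le, quadMul_basis_of_lt e h]

/-- The left action of `A` on the symbols. -/
noncomputable def actLeft : A →ₗ[k] (I × I →₀ k) →ₗ[k] QuadSpace k A I :=
  e.constr k fun i => Finsupp.linearCombination k fun p =>
    if i ≤ p.1 then 0 else
      quadMul e (br (k := k) (e i) (e p.1)) (e p.2)
        - (tri (k := k) (e i) (e p.1) (e p.2), 0) + (tri (k := k) (e p.1) (e i) (e p.2), 0)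
        + if i ≤ p.2 then 0 else quadMul e (e p.1) (br (k := k) (e i) (e p.2))

theorem actLeft_single_of_le {i j : I} (h : i ≤ j) (l : I) :
    actLeft e (e i) (.single (j, l) 1) = 0 := by
  simp [actLeft, h]

/-- For `j ≤ l` this is reduction by `h_{ijl}`. The term `e_j (e_i e_l)` left over is a normal
cubic, hence zero, when `i ≤ l`; otherwise `e_i e_l` is first rewritten by `f_{il}`, which leaves
`e_j [e_i, e_l]`. -/
theorem actLeft_single_of_lt {i j : I} (h : j < i) (l : I) :
    actLeft e (e i) (.single (j, l) 1) =
      quadMul e (br (k := k) (e i) (e j)) (e l)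
        - (tri (k := k) (e i) (e j) (e l), 0) + (tri (k := k) (e j) (e i) (e l), 0)
        + if i ≤ l then 0 else quadMul e (e j) (br (k := k) (e i) (e l)) := by
  simp [actLeft, h.not_ge]

/-- Left multiplication by elements of `A`. -/
noncomputable def mulLeft : A →ₗ[k] QuadSpace k A I →ₗ[k] QuadSpace k A I :=
  (quadMul e).compl₂ (LinearMap.fst k A (I × I →₀ k)) +
    (actLeft e).compl₂ (LinearMap.snd k A (I × I →₀ k))

theorem mulLeft_apply (x : A) (t : QuadSpace k A I) :
    mulLeft e x t = quadMul e x t.1 + actLeft e x t.2 := rfl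

/-- The trilinear map `x (y z) + (x, y, z)`. -/
noncomputable def leftAssoc : A →ₗ[k] A →ₗ[k] A →ₗ[k] QuadSpace k A I :=
  LinearMap.mk₂ k (fun x y => mulLeft e x ∘ₗ quadMul e y
      + LinearMap.inl k A (I × I →₀ k) ∘ₗ tri (k := k) x y)
    (by intros; ext1; simp only [map_add, LinearMap.add_apply, LinearMap.comp_apply]; abel)
    (by intros; ext1; simp)
    (by intros; ext1; simp only [map_add, LinearMap.add_apply, LinearMap.comp_apply]; abel)
    (by intros; ext1; simp)

theorem leftAssoc_apply (x y z : A) :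
    leftAssoc e x y z = mulLeft e x (quadMul e y z) + (tri (k := k) x y z, 0) := rfl

/-- For `j ≤ l` this is how the left action was chosen. For `l < j < i` it is a genuine condition,
and the Akivis identity is what fulfils it. -/
theorem leftAssoc_basis_sub_swap {i j : I} (hij : j < i) (l : I) :
    leftAssoc e (e i) (e j) (e l) - leftAssoc e (e j) (e i) (e l) =
      quadMul e (br (k := k) (e i) (e j)) (e l) := by
  simp only [leftAssoc_apply, mulLeft_apply]
  rcases le_or_gt j l with hjl | hlj
  · rw [quadMul_basis_of_le e hjl, actLeft_single_of_lt e hij]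
    rcases le_or_gt i l with hil | hli
    · rw [quadMul_basis_of_le e hil, actLeft_single_of_le e hij.le, if_pos hil]
      simp only [map_zero, zero_add, add_zero]
      abel
    · rw [quadMul_basis_of_lt e hli, actLeft_single_of_le e hjl, if_neg hli.not_ge]
      simp only [map_zero, zero_add, add_zero]
      abel
  · have hli := hlj.trans hij
    rw [quadMul_basis_of_lt e hlj, quadMul_basis_of_lt e hli, actLeft_single_of_lt e hli,
      actLeft_single_of_lt e hlj, if_neg hij.not_ge, if_pos hij.le]
    -- The quadratic terms pair up into commutators of a basis vector with a bracket, so only double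
    -- brackets and ternary products survive.
    have h1 := quadMul_sub_swap e (e i) (br (k := k) (e j) (e l))
    have h2 := quadMul_sub_swap e (e j) (br (k := k) (e i) (e l))
    have h3 := quadMul_sub_swap e (e l) (br (k := k) (e i) (e j))
    rw [sub_eq_iff_eq_add] at h1 h2 h3
    dsimp only
    rw [h1, h2, h3]
    have h := akivis (k := k) (e i) (e j) (e l)
    rw [br_swap (e i) (e l), br_swap (e i) (br (k := k) (e j) (e l)),
      br_swap (e l) (br (k := k) (e i) (e j)), map_neg, LinearMap.neg_apply,
      br_swap (e j) (br (k := k) (e i) (e l)), ← sub_eq_zero] at h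
    ext1
    · simp only [Prod.fst_add, Prod.fst_sub, Prod.fst_zero]
      rw [← sub_eq_zero]
      refine Eq.trans ?_ (neg_eq_zero.2 h)
      abel
    · simp only [Prod.snd_add, Prod.snd_sub, Prod.snd_zero]
      abel

theorem leftAssoc_sub_swap (x y z : A) :
    leftAssoc e x y z - leftAssoc e y x z = quadMul e (br (k := k) x y) z := by
  refine sub_swap_ext₃ e (leftAssoc e) ((br (k := k) (A := A)).compr₂ (quadMul e))
    (fun i j l => ?_) x y z
  rcases lt_trichotomy i j with h | rfl | h
  · have := leftAssoc_basis_sub_swap e h l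
    rw [br_swap, map_neg, LinearMap.neg_apply, ← neg_inj, neg_sub, neg_neg] at this
    exact this
  · simp [br_self]
  · exact leftAssoc_basis_sub_swap e h l

/-- The right action of `A` on the symbols. -/
noncomputable def actRight : (I × I →₀ k) →ₗ[k] A →ₗ[k] QuadSpace k A I :=
  Finsupp.linearCombination k fun p =>
    leftAssoc e (e p.1) (e p.2)

theorem actRight_single (i j : I) (z : A) :
    actRight e (.single (i, j) 1) z =
      leftAssoc e (e i) (e j) z := by
  simp [actRight]

/-- For `e_i e_j` with `i ≤ j` this is the definition of the right action. For `i > j` the product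
is `[e_i, e_j]` plus the symbol `(j, i)`, and `leftAssoc_sub_swap` supplies the difference. -/
theorem quadMul_quadMul (x y z : A) :
    quadMul e (quadMul e x y).1 z + actRight e (quadMul e x y).2 z =
      leftAssoc e x y z := by
  let F : A →ₗ[k] A →ₗ[k] A →ₗ[k] QuadSpace k A I :=
    (quadMul e).compr₂ (quadMul e ∘ₗ LinearMap.fst k A (I × I →₀ k)
      + actRight e ∘ₗ LinearMap.snd k A (I × I →₀ k))
  have h : F = leftAssoc e := by
    refine e.ext fun i => e.ext fun j => LinearMap.ext fun z => ?_
    change quadMul e (quadMul e (e i) (e j)).1 z + actRight e (quadMul e (e i) (e j)).2 z = _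
    rcases le_or_gt i j with h | h
    · rw [quadMul_basis_of_le e h, actRight_single]
      simp
    · rw [quadMul_basis_of_lt e h, actRight_single, ← leftAssoc_sub_swap]
      exact sub_add_cancel _ _
  exact congr($h x y z)

/-- The space `A ⊕ S²A` with its algebra structure. -/
def QuadAlg (_ : Module.Basis I k A) : Type _ := QuadSpace k A I

noncomputable instance : AddCommGroup (QuadAlg e) := inferInstanceAs (AddCommGroup (QuadSpace k A I))

noncomputable instance : Module k (QuadAlg e) := inferInstanceAs (Module k (QuadSpace k A I))

/-- The product of `QuadAlg e`. The product of two symbols is zero. -/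
noncomputable def quadAlgMul : QuadAlg e →ₗ[k] QuadAlg e →ₗ[k] QuadAlg e :=
  (quadMul e).compl₁₂ (LinearMap.fst k A (I × I →₀ k)) (LinearMap.fst k A (I × I →₀ k)) +
    (actLeft e).compl₁₂ (LinearMap.fst k A (I × I →₀ k)) (LinearMap.snd k A (I × I →₀ k)) +
    (actRight e).compl₁₂ (LinearMap.snd k A (I × I →₀ k)) (LinearMap.fst k A (I × I →₀ k))

noncomputable instance : Mul (QuadAlg e) := ⟨fun x y => quadAlgMul e x y⟩

noncomputable instance : NonUnitalNonAssocRing (QuadAlg e) :=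
  { (inferInstance : AddCommGroup (QuadAlg e)), (inferInstance : Mul (QuadAlg e)) with
    left_distrib := fun a b c => map_add (quadAlgMul e a) b c
    right_distrib := fun a b c => LinearMap.map_add₂ (quadAlgMul e) a b c
    zero_mul := fun a => LinearMap.map_zero₂ (quadAlgMul e) a
    mul_zero := fun a => map_zero (quadAlgMul e a) }

instance : IsScalarTower k (QuadAlg e) (QuadAlg e) :=
  ⟨fun c x y => LinearMap.map_smul₂ (quadAlgMul e) c x y⟩

instance : SMulCommClass k (QuadAlg e) (QuadAlg e) :=
  ⟨fun c x y => ((quadAlgMul e x).map_smul c y).symm⟩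

/-- The inclusion of `A` in `QuadAlg e`. -/
noncomputable def quadIncl : A →ₗ[k] QuadAlg e := LinearMap.inl k A (I × I →₀ k)

theorem quadIncl_injective : Function.Injective (quadIncl e) := LinearMap.inl_injective

theorem quadIncl_mul_quadIncl (x y : A) : quadIncl e x * quadIncl e y = quadMul e x y := by
  change quadMul e x y + actLeft e x 0 + actRight e 0 y = _
  simp

theorem quadIncl_br (x y : A) : quadIncl e x * quadIncl e y - quadIncl e y * quadIncl e x
    - quadIncl e (br (k := k) x y) = 0 := by
  rw [quadIncl_mul_quadIncl, quadIncl_mul_quadIncl, sub_eq_zero]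
  exact quadMul_sub_swap e x y

theorem quadIncl_tri (x y z : A) : quadIncl e x * quadIncl e y * quadIncl e z
    - quadIncl e x * (quadIncl e y * quadIncl e z) - quadIncl e (tri (k := k) x y z) = 0 := by
  rw [quadIncl_mul_quadIncl, quadIncl_mul_quadIncl, sub_sub, sub_eq_zero]
  -- When one factor lies in `A`, one of the two action terms vanishes; `h1` and `h2` record what
  -- remains.
  have h1 : ∀ t : QuadSpace k A I, quadAlgMul e t (quadIncl e z)
      = quadMul e t.1 z + actRight e t.2 z := fun t => by
    change quadMul e t.1 z + actLeft e t.1 0 + actRight e t.2 z = _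
    simp
  have h2 : ∀ t : QuadSpace k A I, quadAlgMul e (quadIncl e x) t = mulLeft e x t := fun t => by
    change quadMul e x t.1 + actLeft e x t.2 + actRight e 0 t.1
      = quadMul e x t.1 + actLeft e x t.2
    simp
  refine (h1 _).trans ((quadMul_quadMul e x y z).trans ?_)
  rw [leftAssoc_apply, ← h2]
  rfl

end Model

/-! ### The map `A → U(A)` and its injectivity -/

section Embedding

variable {k A I : Type*} [Field k] [AddCommGroup A] [Module k A] [AkivisAlgebra k A]
  (e : Module.Basis I k A)

omit [AkivisAlgebra k A] in
@[simp]
theorem lin_basis (i : I) : lin e (e i) = letter k i := by simp [lin]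

theorem ι_apply (x : A) : ι e x = QuotAlg.mk (relations e) (lin e x) := by
  have h : ι e = QuotAlg.mk (relations e) ∘ₗ lin e := e.ext fun i => by simp [ι]
  exact congr($h x)

theorem ι_br (x y : A) : ι e (br (k := k) x y) = ι e x * ι e y - ι e y * ι e x := by
  let m := LinearMap.mul k (UEnv e)
  have h : (br (k := k) (A := A)).compr₂ (ι e)
      = m.compl₁₂ (ι e) (ι e) - (m.compl₁₂ (ι e) (ι e)).flip := by
    refine e.ext fun i => e.ext fun j => ?_
    simp only [m, LinearMap.compr₂_apply, LinearMap.sub_apply, LinearMap.flip_apply,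
      LinearMap.compl₁₂_apply, LinearMap.mul_apply', ι_apply, lin_basis, ← QuotAlg.mk_mul,
      ← map_sub]
    refine ((QuotAlg.mk_eq_mk _).2 ?_).symm
    exact Submodule.mem_sInf.2 fun J hJ => hJ.1 (Or.inl ⟨i, j, rfl⟩)
  exact congr($h x y)

theorem ι_tri (x y z : A) :
    ι e (tri (k := k) x y z) = ι e x * ι e y * ι e z - ι e x * (ι e y * ι e z) := by
  let m := LinearMap.mul k (UEnv e)
  let F : A →ₗ[k] A →ₗ[k] A →ₗ[k] UEnv e := LinearMap.mk₂ k (fun x y => ι e ∘ₗ tri (k := k) x y)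
      (by intros; ext1; simp) (by intros; ext1; simp) (by intros; ext1; simp)
      (by intros; ext1; simp)
  let G : A →ₗ[k] A →ₗ[k] A →ₗ[k] UEnv e :=
    LinearMap.mk₂ k (fun x y => m (ι e x * ι e y) ∘ₗ ι e - m (ι e x) ∘ₗ m (ι e y) ∘ₗ ι e)
      (by intros; ext1; simp [m, add_mul]; abel)
      (by intros; ext1; simp [m, smul_sub, smul_mul_assoc])
      (by intros; ext1; simp [m, mul_add]; abel)
      (by intros; ext1; simp [m, smul_sub, mul_smul_comm])
  have h : F = G := by
    refine e.ext fun i => e.ext fun j => e.ext fun l => ?_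
    change ι e (tri (k := k) (e i) (e j) (e l))
      = ι e (e i) * ι e (e j) * ι e (e l) - ι e (e i) * (ι e (e j) * ι e (e l))
    simp only [ι_apply, lin_basis, ← QuotAlg.mk_mul, ← map_sub]
    refine ((QuotAlg.mk_eq_mk _).2 ?_).symm
    exact Submodule.mem_sInf.2 fun J hJ => hJ.1 (Or.inr ⟨i, j, l, rfl⟩)
  exact congr($h x y z)

/-- The homomorphism from `M(X)` to the model that sends letters to basis vectors kills the
relations, and it restricts to the inclusion of `A` on linear polynomials. -/
theorem ι_injective [LinearOrder I] : Function.Injective (ι e) := by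
  let φ := FreeNonUnitalNonAssocAlgebra.lift k fun i => quadIncl e (e i)
  let φl : FreeNonUnitalNonAssocAlgebra k I →ₗ[k] QuadAlg e := (φ : _ →ₗ[k] _)
  have hlin : ∀ x, φ (lin e x) = quadIncl e x := fun x => by
    have h : φl ∘ₗ lin e = quadIncl e := e.ext fun i => by
      simp only [LinearMap.comp_apply, lin_basis]
      exact FreeNonUnitalNonAssocAlgebra.lift_of_apply k _ i
    exact congr($h x)
  have hletter : ∀ i, φ (letter k i) = quadIncl e (e i) := fun i => by
    rw [← lin_basis e, hlin]
  -- The kernel is one of the subspaces in the infimum that defines `idealSpan`.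
  have hker : idealSpan k (relations e) ≤ LinearMap.ker φl := by
    refine sInf_le ⟨?_, fun x hx y => ?_⟩
    · rintro _ (⟨i, j, rfl⟩ | ⟨i, j, l, rfl⟩)
      · change φ (fPoly e i j) = 0
        simp only [fPoly, map_sub, map_mul, hlin, hletter, quadIncl_br]
      · change φ (gPoly e i j l) = 0
        simp only [gPoly, map_sub, map_mul, hlin, hletter, quadIncl_tri]
    · have hx : φ x = 0 := hx
      constructor
      · change φ (y * x) = 0
        rw [map_mul, hx, mul_zero]
      · change φ (x * y) = 0
        rw [map_mul, hx, zero_mul]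
  intro x y hxy
  rw [ι_apply, ι_apply, QuotAlg.mk_eq_mk] at hxy
  have h : φ (lin e x - lin e y) = 0 := hker hxy
  rw [map_sub, hlin, hlin, sub_eq_zero] at h
  exact quadIncl_injective e h

end Embedding

end AkivisAlgebra

namespace NonAssoc

/-! ### Subwords and the deg-lex order -/

section Words

variable {X : Type*}

theorem mul_eq_mul_iff {u₁ u₂ v₁ v₂ : FreeMagma X} :
    u₁ * u₂ = v₁ * v₂ ↔ u₁ = v₁ ∧ u₂ = v₂ :=
  ⟨fun h => by cases h; exact ⟨rfl, rfl⟩, fun h => by rw [h.1, h.2]⟩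

theorem of_injective : Function.Injective (FreeMagma.of : X → FreeMagma X) :=
  fun _ _ h => by cases h; rfl

theorem of_ne_mul (x : X) (u v : FreeMagma X) : FreeMagma.of x ≠ u * v := by
  simp only [← FreeMagma.mul_eq, ne_eq, reduceCtorEq, not_false_eq_true]

theorem WordCtx.of_ne_fillWord_mul (x : X) (c : WordCtx X) (u v : FreeMagma X) :
    FreeMagma.of x ≠ c.fillWord (u * v) := by
  cases c <;> exact of_ne_mul _ _ _

/-- The proper subwords of a word of length two are letters, so a product can only sit in it at the
root. -/
theorem WordCtx.eq_hole_of_of_mul_of {x y : X} {c : WordCtx X} {u v : FreeMagma X}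
    (h : FreeMagma.of x * FreeMagma.of y = c.fillWord (u * v)) :
    c = .hole ∧ u = .of x ∧ v = .of y := by
  cases c with
  | hole => exact ⟨rfl, (mul_eq_mul_iff.1 h).1.symm, (mul_eq_mul_iff.1 h).2.symm⟩
  | mulRight c w => exact absurd (mul_eq_mul_iff.1 h).1 (of_ne_fillWord_mul _ _ _ _)
  | mulLeft w c => exact absurd (mul_eq_mul_iff.1 h).2 (of_ne_fillWord_mul _ _ _ _)

variable [LinearOrder X]

theorem wordLT_of_of {x y : X} : WordLT (.of x) (.of y) ↔ x < y := by
  simp [WordLT]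

theorem wordLT_of_mul (x : X) (u v : FreeMagma X) : WordLT (.of x) (u * v) := by
  simp [WordLT]

theorem not_wordLT_mul_of (x : X) (u v : FreeMagma X) : ¬ WordLT (u * v) (.of x) := by
  simp [WordLT]

theorem wordLT_mul_mul {u₁ u₂ v₁ v₂ : FreeMagma X} : WordLT (u₁ * u₂) (v₁ * v₂) ↔
    (u₁ * u₂).length < (v₁ * v₂).length ∨
      ((u₁ * u₂).length = (v₁ * v₂).length ∧ (WordLT u₁ v₁ ∨ (u₁ = v₁ ∧ WordLT u₂ v₂))) := by
  rw [← FreeMagma.mul_eq u₁ u₂, ← FreeMagma.mul_eq v₁ v₂, WordLT]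
  rfl

theorem WordLT.asymm {u v : FreeMagma X} (h : WordLT u v) : ¬ WordLT v u := by
  induction u using FreeMagma.recOnMul generalizing v with
  | ih1 x =>
    cases v using FreeMagma.recOnMul with
    | ih1 y => rw [wordLT_of_of] at *; exact h.asymm
    | ih2 v₁ v₂ => exact not_wordLT_mul_of _ _ _
  | ih2 u₁ u₂ h₁ h₂ =>
    cases v using FreeMagma.recOnMul with
    | ih1 y => exact absurd h (not_wordLT_mul_of _ _ _)
    | ih2 v₁ v₂ =>
      rw [wordLT_mul_mul] at *
      rintro (h' | ⟨e', h' | ⟨q', h'⟩⟩) <;> rcases h with (h | ⟨e, h | ⟨q, h⟩⟩)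
      -- A strict length comparison contradicts the other hypothesis; the four purely lexicographic
      -- cases remain.
      any_goals omega
      · exact h₁ h h'
      · subst q
        exact h₁ h' h'
      · subst q'
        exact h₁ h h
      · exact h₂ h h'

theorem wordLT_irrefl (u : FreeMagma X) : ¬ WordLT u u := fun h => h.asymm h

end Words

/-! ### Leading words and triviality modulo `(S, w)` -/

section Leading

variable {k X : Type*} [Field k] [LinearOrder X]

theorem IsLeadingWord.unique {f : FreeNonUnitalNonAssocAlgebra k X} {u v : FreeMagma X}
    (hu : IsLeadingWord f u) (hv : IsLeadingWord f v) : u = v := by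
  by_contra h
  exact (hu.2 v hv.1 (Ne.symm h)).asymm (hv.2 u hu.1 h)

variable (k) in
/-- The polynomials all of whose words are smaller than `w`. -/
def lowerPolys (w : FreeMagma X) : Submodule k (FreeNonUnitalNonAssocAlgebra k X) where
  carrier := {p | ∀ u, ¬ WordLT u w → p.coeff u = 0}
  add_mem' ha hb u hu := by
    rw [MonoidAlgebra.coeff_add, Finsupp.add_apply, ha u hu, hb u hu, add_zero]
  zero_mem' u _ := rfl
  smul_mem' c p hp u hu := by
    rw [MonoidAlgebra.coeff_smul_apply, hp u hu, smul_zero]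

theorem ofMagma_mem_lowerPolys {u w : FreeMagma X} (h : WordLT u w) :
    MonoidAlgebra.ofMagma k _ u ∈ lowerPolys k w := by
  classical
  intro v hv
  have huv : u ≠ v := fun huv => hv (huv ▸ h)
  change (MonoidAlgebra.single u (1 : k)).coeff v = 0
  rw [MonoidAlgebra.coeff_single, Finsupp.single_eq_of_ne huv.symm]

theorem coeff_eq_one_of_sub_mem {f : FreeNonUnitalNonAssocAlgebra k X} {w : FreeMagma X}
    (h : f - MonoidAlgebra.ofMagma k _ w ∈ lowerPolys k w) : f.coeff w = 1 := by
  have h := h w (wordLT_irrefl w)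
  rw [MonoidAlgebra.coeff_sub, Finsupp.sub_apply, sub_eq_zero] at h
  rw [h]
  change (MonoidAlgebra.single w (1 : k)).coeff w = 1
  rw [MonoidAlgebra.coeff_single, Finsupp.single_eq_same]

/-- A word other than `w` that is not below `w` has coefficient zero in both `f - w` and `w`, hence
in `f`. -/
theorem isLeadingWord_of_sub_mem {f : FreeNonUnitalNonAssocAlgebra k X} {w : FreeMagma X}
    (h : f - MonoidAlgebra.ofMagma k _ w ∈ lowerPolys k w) : IsLeadingWord f w := by
  constructor
  · rw [Finsupp.mem_support_iff, coeff_eq_one_of_sub_mem h]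
    exact one_ne_zero
  · intro u hu huw
    by_contra hlt
    have h := h u hlt
    rw [MonoidAlgebra.coeff_sub, Finsupp.sub_apply, sub_eq_zero] at h
    refine Finsupp.mem_support_iff.1 hu (h.trans ?_)
    change (MonoidAlgebra.single w (1 : k)).coeff u = 0
    rw [MonoidAlgebra.coeff_single, Finsupp.single_eq_of_ne huw]

theorem subset_idealSpan {B : Type*} [NonUnitalNonAssocRing B] [Module k B] (S : Set B) :
    S ⊆ idealSpan k S :=
  fun _ hx => Submodule.mem_sInf.2 fun _ hJ => hJ.1 hx

theorem idealSpan_le {B : Type*} [NonUnitalNonAssocRing B] [Module k B] {S T : Set B}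
    (h : S ⊆ idealSpan k T) : idealSpan k S ≤ idealSpan k T :=
  sInf_le ⟨h, fun _ hx y => idealSpan_mul_mem T hx y⟩

theorem trivialMod_fillPoly {S : Set (FreeNonUnitalNonAssocAlgebra k X)}
    {s : FreeNonUnitalNonAssocAlgebra k X} (hs : s ∈ S) {v w : FreeMagma X} (c : WordCtx X)
    (hv : IsLeadingWord s v) (hw : WordLT (c.fillWord v) w) : TrivialMod S w (c.fillPoly s) :=
  Submodule.subset_span ⟨s, hs, v, c, hv, hw, rfl⟩

theorem trivialMod_zero (S : Set (FreeNonUnitalNonAssocAlgebra k X)) (w : FreeMagma X) :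
    TrivialMod S w 0 :=
  zero_mem _

theorem TrivialMod.add {S : Set (FreeNonUnitalNonAssocAlgebra k X)} {w : FreeMagma X}
    {p q : FreeNonUnitalNonAssocAlgebra k X} (hp : TrivialMod S w p) (hq : TrivialMod S w q) :
    TrivialMod S w (p + q) :=
  add_mem hp hq

theorem TrivialMod.sub {S : Set (FreeNonUnitalNonAssocAlgebra k X)} {w : FreeMagma X}
    {p q : FreeNonUnitalNonAssocAlgebra k X} (hp : TrivialMod S w p) (hq : TrivialMod S w q) :
    TrivialMod S w (p - q) :=
  sub_mem hp hq

theorem TrivialMod.neg {S : Set (FreeNonUnitalNonAssocAlgebra k X)} {w : FreeMagma X}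
    {p : FreeNonUnitalNonAssocAlgebra k X} (hp : TrivialMod S w p) : TrivialMod S w (-p) :=
  neg_mem hp

end Leading

end NonAssoc

namespace AkivisAlgebra

open NonAssoc

/-! ### Linear polynomials and letters as words -/

section Basic

variable {k A I N : Type*} [Field k] [AddCommGroup A] [Module k A] [AddCommGroup N] [Module k N]

theorem map_mem_of_basis (e : Module.Basis I k A) (φ : A →ₗ[k] N) (J : Submodule k N)
    (h : ∀ i, φ (e i) ∈ J) (x : A) : φ x ∈ J := by
  have hle : Submodule.span k (Set.range e) ≤ J.comap φ :=
    Submodule.span_le.2 (by rintro _ ⟨i, rfl⟩; exact h i)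
  exact hle (e.mem_span x)

theorem letter_mul_letter (i j : I) :
    letter k i * letter k j = MonoidAlgebra.ofMagma k _ (FreeMagma.of i * FreeMagma.of j) :=
  (map_mul (MonoidAlgebra.ofMagma k (FreeMagma I)) _ _).symm

theorem letter_mul_letter_mul_letter (i j l : I) :
    letter k i * (letter k j * letter k l) =
      MonoidAlgebra.ofMagma k _ (FreeMagma.of i * (FreeMagma.of j * FreeMagma.of l)) := by
  simp only [map_mul]
  rfl

theorem letter_mul_letter_mul_letter' (i j l : I) :
    letter k i * letter k j * letter k l =
      MonoidAlgebra.ofMagma k _ (FreeMagma.of i * FreeMagma.of j * FreeMagma.of l) := by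
  simp only [map_mul]
  rfl

theorem lin_mem_lowerPolys [LinearOrder I] (e : Module.Basis I k A) (x : A) (u v : FreeMagma I) :
    lin e x ∈ lowerPolys k (u * v) := by
  refine map_mem_of_basis e (lin e) _ (fun i => ?_) x
  rw [lin_basis]
  exact ofMagma_mem_lowerPolys (wordLT_of_mul ..)

theorem lin_mul_letter_mem_lowerPolys [LinearOrder I] (e : Module.Basis I k A) (x : A)
    (l : I) {w : FreeMagma I} (hw : ∀ i, WordLT (.of i * .of l) w) :
    lin e x * letter k l ∈ lowerPolys k w := by
  refine map_mem_of_basis e ((LinearMap.mul k _).flip (letter k l) ∘ₗ lin e) _ (fun i => ?_) x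
  simp only [LinearMap.comp_apply, LinearMap.flip_apply, LinearMap.mul_apply', lin_basis,
    letter_mul_letter]
  exact ofMagma_mem_lowerPolys (hw i)

end Basic

/-! ### The compositions of `S` and the ideal it generates -/

section GroebnerShirshov

variable {k A I : Type*} [Field k] [AddCommGroup A] [Module k A] [AkivisAlgebra k A]
  (e : Module.Basis I k A)

theorem fPoly_self (i : I) : fPoly e i i = 0 := by
  simp [fPoly, br_self]

theorem fPoly_swap (i j : I) : fPoly e j i = -fPoly e i j := by
  rw [fPoly, fPoly, br_swap, map_neg]
  abel

/-- The composition of `g_{ijl}` and `f_{ij}`. -/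
theorem gPoly_sub_fPoly_mul (i j l : I) :
    gPoly e i j l - fPoly e i j * letter k l = gPoly e j i l - hPoly e i j l := by
  simp only [gPoly, fPoly, hPoly, sub_mul]
  abel

/-- The expression is bilinear and equals `f_{ij}` on basis vectors. `J` need not be an ideal, so
that it can be the span of the `S`-words below a given word. -/
theorem lin_mul_lin_mem (J : Submodule k (FreeNonUnitalNonAssocAlgebra k I))
    (h : ∀ i j, fPoly e i j ∈ J) (x y : A) :
    lin e x * lin e y - lin e y * lin e x - lin e (br (k := k) x y) ∈ J := by
  let m := (LinearMap.mul k (FreeNonUnitalNonAssocAlgebra k I)).compl₁₂ (lin e) (lin e)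
  let F := m - m.flip - (br (k := k) (A := A)).compr₂ (lin e)
  change F x y ∈ J
  refine map_mem_of_basis e (F.flip y) J (fun i => ?_) x
  refine map_mem_of_basis e (F (e i)) J (fun j => ?_) y
  simpa [F, m, fPoly] using h i j

/-- The reduction of `h_{ijl}` for `l < j < i`. -/
theorem hPoly_eq (i j l : I) : hPoly e i j l =
    letter k i * fPoly e j l + hPoly e i l j - letter k j * fPoly e i l - hPoly e j l i
      + letter k l * fPoly e i j
      + (lin e (e i) * lin e (br (k := k) (e j) (e l)) - lin e (br (k := k) (e j) (e l)) * lin e (e i)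
        - lin e (br (k := k) (e i) (br (k := k) (e j) (e l))))
      - (lin e (e j) * lin e (br (k := k) (e i) (e l)) - lin e (br (k := k) (e i) (e l)) * lin e (e j)
        - lin e (br (k := k) (e j) (br (k := k) (e i) (e l))))
      + (lin e (e l) * lin e (br (k := k) (e i) (e j)) - lin e (br (k := k) (e i) (e j)) * lin e (e l)
        - lin e (br (k := k) (e l) (br (k := k) (e i) (e j)))) := by
  -- Cubic and quadratic terms cancel formally; the linear terms cancel by this identity.
  have h := congr(lin e $(akivis (k := k) (e i) (e j) (e l)))
  rw [br_swap (e i) (e l), br_swap (e i) (br (k := k) (e j) (e l)),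
    br_swap (e l) (br (k := k) (e i) (e j)), map_neg, LinearMap.neg_apply,
    br_swap (e j) (br (k := k) (e i) (e l)), ← sub_eq_zero] at h
  simp only [map_add, map_sub, map_neg] at h
  simp only [fPoly, hPoly, mul_sub, lin_basis]
  rw [← sub_eq_zero]
  refine Eq.trans ?_ (neg_eq_zero.2 h)
  abel

variable [LinearOrder I]

theorem fPoly_sub_mem {i j : I} (h : j < i) :
    fPoly e i j - MonoidAlgebra.ofMagma k _ (.of i * .of j) ∈ lowerPolys k (.of i * .of j) := by
  rw [← letter_mul_letter]
  have : fPoly e i j - letter k i * letter k j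
      = -(letter k j * letter k i) - lin e (br (k := k) (e i) (e j)) := by
    rw [fPoly]; abel
  rw [this, letter_mul_letter]
  refine sub_mem (neg_mem (ofMagma_mem_lowerPolys ?_)) (lin_mem_lowerPolys _ _ _ _)
  simp [wordLT_mul_mul, wordLT_of_of, h]

/-- Both cubic words have length three, and the first factor `e_i e_j` exceeds the letter `e_i`. -/
theorem gPoly_sub_mem (i j l : I) :
    gPoly e i j l - MonoidAlgebra.ofMagma k _ (.of i * .of j * .of l)
      ∈ lowerPolys k (.of i * .of j * .of l) := by
  rw [← letter_mul_letter_mul_letter']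
  have : gPoly e i j l - letter k i * letter k j * letter k l
      = -(letter k i * (letter k j * letter k l)) - lin e (tri (k := k) (e i) (e j) (e l)) := by
    rw [gPoly]; abel
  rw [this, letter_mul_letter_mul_letter]
  refine sub_mem (neg_mem (ofMagma_mem_lowerPolys ?_)) (lin_mem_lowerPolys _ _ _ _)
  simp [wordLT_mul_mul, wordLT_of_mul]

theorem hPoly_sub_mem {i j : I} (h : j < i) (l : I) :
    hPoly e i j l - MonoidAlgebra.ofMagma k _ (.of i * (.of j * .of l))
      ∈ lowerPolys k (.of i * (.of j * .of l)) := by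
  rw [← letter_mul_letter_mul_letter]
  have : hPoly e i j l - letter k i * (letter k j * letter k l)
      = -(letter k j * (letter k i * letter k l))
        - lin e (br (k := k) (e i) (e j)) * letter k l
        - lin e (tri (k := k) (e j) (e i) (e l)) + lin e (tri (k := k) (e i) (e j) (e l)) := by
    rw [hPoly]; abel
  rw [this, letter_mul_letter_mul_letter]
  refine add_mem (sub_mem (sub_mem (neg_mem (ofMagma_mem_lowerPolys ?_))
    (lin_mul_letter_mem_lowerPolys _ _ _ fun m => ?_)) (lin_mem_lowerPolys _ _ _ _))
    (lin_mem_lowerPolys _ _ _ _)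
  · simp [wordLT_mul_mul, wordLT_of_of, h]
  · simp [wordLT_mul_mul]

theorem fPoly_mem {i j : I} (h : j < i) : fPoly e i j ∈ gsSet e := Or.inl (Or.inl ⟨i, j, h, rfl⟩)

theorem gPoly_mem (i j l : I) : gPoly e i j l ∈ gsSet e := Or.inl (Or.inr ⟨i, j, l, rfl⟩)

theorem hPoly_mem {i j l : I} (h : j < i) (hl : j ≤ l) : hPoly e i j l ∈ gsSet e :=
  Or.inr ⟨i, j, l, h, hl, rfl⟩

theorem isMonic_of_mem_gsSet {s : FreeNonUnitalNonAssocAlgebra k I} (hs : s ∈ gsSet e) :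
    IsMonic s := by
  rcases hs with (⟨i, j, h, rfl⟩ | ⟨i, j, l, rfl⟩) | ⟨i, j, l, h, -, rfl⟩
  · exact ⟨_, isLeadingWord_of_sub_mem (fPoly_sub_mem e h),
      coeff_eq_one_of_sub_mem (fPoly_sub_mem e h)⟩
  · exact ⟨_, isLeadingWord_of_sub_mem (gPoly_sub_mem e i j l),
      coeff_eq_one_of_sub_mem (gPoly_sub_mem e i j l)⟩
  · exact ⟨_, isLeadingWord_of_sub_mem (hPoly_sub_mem e h l),
      coeff_eq_one_of_sub_mem (hPoly_sub_mem e h l)⟩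

/-- Only `f_{ij}` with `i > j` lies in `S`; the others are zero or `-f_{ji}`. This is why `h` bounds
all pairs of letters and why `c.fillPoly` must respect negation and zero. -/
theorem trivialMod_fillPoly_fPoly (c : WordCtx I) {w : FreeMagma I} {i j : I}
    (h : ∀ a b, WordLT (c.fillWord (.of a * .of b)) w)
    (hneg : c.fillPoly (-fPoly e i j) = -c.fillPoly (fPoly e i j))
    (hzero : c.fillPoly (0 : FreeNonUnitalNonAssocAlgebra k I) = 0) :
    TrivialMod (gsSet e) w (c.fillPoly (fPoly e i j)) := by
  rcases lt_trichotomy j i with hij | rfl | hij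
  · exact trivialMod_fillPoly (fPoly_mem e hij) c (isLeadingWord_of_sub_mem (fPoly_sub_mem e hij))
      (h i j)
  · rw [fPoly_self, hzero]
    exact trivialMod_zero _ _
  · have := trivialMod_fillPoly (fPoly_mem e hij) c
      (isLeadingWord_of_sub_mem (fPoly_sub_mem e hij)) (h j i)
    rw [fPoly_swap, hneg] at this
    simpa using this.neg

theorem trivialMod_hPoly {i j l : I} (hij : j < i) (hjl : j ≤ l) (a b c : I) :
    TrivialMod (gsSet e) (.of a * .of b * .of c) (hPoly e i j l) := by
  refine trivialMod_fillPoly (hPoly_mem e hij hjl) .hole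
    (isLeadingWord_of_sub_mem (hPoly_sub_mem e hij l)) ?_
  simp [WordCtx.fillWord, wordLT_mul_mul, wordLT_of_mul]

/-- The composition of `g_{ijl}` and `f_{ij}` is trivial. -/
theorem trivialMod_composition {i j : I} (hij : j < i) (l : I) :
    TrivialMod (gsSet e) (.of i * .of j * .of l) (gPoly e i j l - fPoly e i j * letter k l) := by
  rw [gPoly_sub_fPoly_mul]
  refine TrivialMod.sub ?_ ?_
  · refine trivialMod_fillPoly (gPoly_mem e j i l) .hole
      (isLeadingWord_of_sub_mem (gPoly_sub_mem e j i l)) ?_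
    simp [WordCtx.fillWord, wordLT_mul_mul, wordLT_of_of, hij]
  rcases le_or_gt j l with hjl | hlj
  · exact trivialMod_hPoly e hij hjl i j l
  -- With `l < j < i`, `h_{ijl}` is not in `S`, but every summand of `hPoly_eq` is trivial below
  -- `(e_i e_j) e_l`.
  have hf (a b : I) : TrivialMod (gsSet e) (.of i * .of j * .of l) (fPoly e a b) :=
    trivialMod_fillPoly_fPoly e .hole (fun a b => by simp [WordCtx.fillWord, wordLT_mul_mul])
      rfl rfl
  have hef (m a b : I) :
      TrivialMod (gsSet e) (.of i * .of j * .of l) (letter k m * fPoly e a b) :=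
    trivialMod_fillPoly_fPoly e (.mulLeft (.of m) .hole)
      (fun a b => by simp [WordCtx.fillWord, wordLT_mul_mul, wordLT_of_mul])
      (mul_neg _ _) (mul_zero _)
  have hC (x y : A) := lin_mul_lin_mem e _ hf x y
  have hli := hlj.trans hij
  rw [hPoly_eq]
  exact (((((((hef i j l).add (trivialMod_hPoly e hli hlj.le i j l)).sub (hef j i l)).sub
    (trivialMod_hPoly e hlj hli.le i j l)).add (hef l i j)).add (hC _ _)).sub (hC _ _)).add (hC _ _)

/-- The shapes of the leading words decide all nine pairs: equal shapes force the same polynomial in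
the empty context, and only `f` inside `g` gives a nonzero composition. -/
theorem isGroebnerShirshovBasis_gsSet : IsGroebnerShirshovBasis (gsSet e) := by
  refine ⟨fun s => isMonic_of_mem_gsSet e, ?_⟩
  intro f hf g hg u v c hu hv huv
  have lead_f {i j : I} (h : j < i) := isLeadingWord_of_sub_mem (fPoly_sub_mem e h)
  have lead_g (i j l : I) := isLeadingWord_of_sub_mem (gPoly_sub_mem e i j l)
  have lead_h {i j : I} (h : j < i) (l : I) := isLeadingWord_of_sub_mem (hPoly_sub_mem e h l)
  have self (p : FreeNonUnitalNonAssocAlgebra k I) :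
      TrivialMod (gsSet e) u (p - WordCtx.hole.fillPoly p) := by
    rw [WordCtx.fillPoly, sub_self]
    exact trivialMod_zero _ _
  rcases hf with (⟨i, j, hij, rfl⟩ | ⟨i, j, l, rfl⟩) | ⟨i, j, l, hij, hjl, rfl⟩
  · obtain rfl := hu.unique (lead_f hij)
    rcases hg with (⟨a, b, hab, rfl⟩ | ⟨a, b, d, rfl⟩) | ⟨a, b, d, hab, hbd, rfl⟩
    · obtain rfl := hv.unique (lead_f hab)
      obtain ⟨rfl, ha, hb⟩ := WordCtx.eq_hole_of_of_mul_of huv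
      obtain rfl := of_injective ha
      obtain rfl := of_injective hb
      exact self _
    · obtain rfl := hv.unique (lead_g a b d)
      exact absurd (WordCtx.eq_hole_of_of_mul_of huv).2.1.symm (of_ne_mul _ _ _)
    · obtain rfl := hv.unique (lead_h hab d)
      exact absurd (WordCtx.eq_hole_of_of_mul_of huv).2.2.symm (of_ne_mul _ _ _)
  · obtain rfl := hu.unique (lead_g i j l)
    rcases hg with (⟨a, b, hab, rfl⟩ | ⟨a, b, d, rfl⟩) | ⟨a, b, d, hab, hbd, rfl⟩
    · obtain rfl := hv.unique (lead_f hab)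
      cases c with
      | hole => exact absurd (mul_eq_mul_iff.1 huv).1.symm (of_ne_mul _ _ _)
      | mulLeft w c => exact absurd (mul_eq_mul_iff.1 huv).2 (WordCtx.of_ne_fillWord_mul _ _ _ _)
      | mulRight c w =>
        obtain ⟨h₁, rfl⟩ := mul_eq_mul_iff.1 huv
        obtain ⟨rfl, ha, hb⟩ := WordCtx.eq_hole_of_of_mul_of h₁
        obtain rfl := of_injective ha
        obtain rfl := of_injective hb
        exact trivialMod_composition e hab l
    · obtain rfl := hv.unique (lead_g a b d)
      cases c with
      | hole =>
        obtain ⟨h₁, hd⟩ := mul_eq_mul_iff.1 huv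
        obtain ⟨ha, hb⟩ := mul_eq_mul_iff.1 h₁
        obtain rfl := of_injective ha
        obtain rfl := of_injective hb
        obtain rfl := of_injective hd
        exact self _
      | mulLeft w c => exact absurd (mul_eq_mul_iff.1 huv).2 (WordCtx.of_ne_fillWord_mul _ _ _ _)
      | mulRight c w =>
        exact absurd (WordCtx.eq_hole_of_of_mul_of (mul_eq_mul_iff.1 huv).1).2.1.symm
          (of_ne_mul _ _ _)
    · obtain rfl := hv.unique (lead_h hab d)
      cases c with
      | hole => exact absurd (mul_eq_mul_iff.1 huv).1.symm (of_ne_mul _ _ _)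
      | mulLeft w c => exact absurd (mul_eq_mul_iff.1 huv).2 (WordCtx.of_ne_fillWord_mul _ _ _ _)
      | mulRight c w =>
        exact absurd (WordCtx.eq_hole_of_of_mul_of (mul_eq_mul_iff.1 huv).1).2.2.symm
          (of_ne_mul _ _ _)
  · obtain rfl := hu.unique (lead_h hij l)
    rcases hg with (⟨a, b, hab, rfl⟩ | ⟨a, b, d, rfl⟩) | ⟨a, b, d, hab, hbd, rfl⟩
    · obtain rfl := hv.unique (lead_f hab)
      cases c with
      | hole => exact absurd (mul_eq_mul_iff.1 huv).2.symm (of_ne_mul _ _ _)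
      | mulRight c w => exact absurd (mul_eq_mul_iff.1 huv).1 (WordCtx.of_ne_fillWord_mul _ _ _ _)
      | mulLeft w c =>
        obtain ⟨rfl, ha, hb⟩ := WordCtx.eq_hole_of_of_mul_of (mul_eq_mul_iff.1 huv).2
        obtain rfl := of_injective ha
        obtain rfl := of_injective hb
        -- The condition `l ≥ j` on `h_{ijl}` keeps the leading word of an `f` out of `e_j e_l`.
        exact absurd hab (not_lt_of_ge hjl)
    · obtain rfl := hv.unique (lead_g a b d)
      cases c with
      | hole => exact absurd (mul_eq_mul_iff.1 huv).1 (of_ne_mul _ _ _)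
      | mulRight c w => exact absurd (mul_eq_mul_iff.1 huv).1 (WordCtx.of_ne_fillWord_mul _ _ _ _)
      | mulLeft w c =>
        exact absurd (WordCtx.eq_hole_of_of_mul_of (mul_eq_mul_iff.1 huv).2).2.1.symm
          (of_ne_mul _ _ _)
    · obtain rfl := hv.unique (lead_h hab d)
      cases c with
      | hole =>
        obtain ⟨ha, h₂⟩ := mul_eq_mul_iff.1 huv
        obtain ⟨hb, hd⟩ := mul_eq_mul_iff.1 h₂
        obtain rfl := of_injective ha
        obtain rfl := of_injective hb
        obtain rfl := of_injective hd
        exact self _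
      | mulRight c w => exact absurd (mul_eq_mul_iff.1 huv).1 (WordCtx.of_ne_fillWord_mul _ _ _ _)
      | mulLeft w c =>
        exact absurd (WordCtx.eq_hole_of_of_mul_of (mul_eq_mul_iff.1 huv).2).2.2.symm
          (of_ne_mul _ _ _)

/-- Each `h_{ijl}` equals `g_{jil} - (g_{ijl} - f_{ij} e_l)`, and the `f_{ij}` with `i ≤ j` are
recovered by antisymmetry. -/
theorem idealSpan_gsSet : idealSpan k (gsSet e) = idealSpan k (relations e) := by
  refine le_antisymm (idealSpan_le ?_) (idealSpan_le ?_)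
  · have hf (i j : I) : fPoly e i j ∈ idealSpan k (relations e) :=
      subset_idealSpan _ (Or.inl ⟨i, j, rfl⟩)
    have hg (i j l : I) : gPoly e i j l ∈ idealSpan k (relations e) :=
      subset_idealSpan _ (Or.inr ⟨i, j, l, rfl⟩)
    rintro _ ((⟨i, j, -, rfl⟩ | ⟨i, j, l, rfl⟩) | ⟨i, j, l, -, -, rfl⟩)
    · exact hf i j
    · exact hg i j l
    · rw [SetLike.mem_coe, ← sub_sub_cancel (gPoly e j i l) (hPoly e i j l),
        ← gPoly_sub_fPoly_mul]
      exact sub_mem (hg j i l) (sub_mem (hg i j l) (idealSpan_mul_mem _ (hf i j) _).2)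
  · rintro _ (⟨i, j, rfl⟩ | ⟨i, j, l, rfl⟩)
    · rcases lt_trichotomy j i with hij | rfl | hij
      · exact subset_idealSpan _ (fPoly_mem e hij)
      · rw [fPoly_self]
        exact zero_mem _
      · rw [fPoly_swap]
        exact neg_mem (subset_idealSpan _ (fPoly_mem e hij))
    · exact subset_idealSpan _ (gPoly_mem e i j l)

end GroebnerShirshov

end AkivisAlgebra

theorem mainTheorem1 {k A I : Type*} [Field k] [AddCommGroup A] [Module k A] [AkivisAlgebra k A]
    [LinearOrder I] (e : Module.Basis I k A) :
    -- `S` is a Gröbner–Shirshov basis, and it generates the ideal of relations of `U(A)`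
    (NonAssoc.IsGroebnerShirshovBasis (AkivisAlgebra.gsSet e) ∧
      NonAssoc.idealSpan k (AkivisAlgebra.gsSet e) =
        NonAssoc.idealSpan k (AkivisAlgebra.relations e)) ∧
    -- the canonical map embeds `A` into `U(A)` with its commutator and associator
    (Function.Injective (AkivisAlgebra.ι e) ∧
      (∀ x y : A, AkivisAlgebra.ι e (AkivisAlgebra.br (k := k) x y) =
        AkivisAlgebra.ι e x * AkivisAlgebra.ι e y - AkivisAlgebra.ι e y * AkivisAlgebra.ι e x) ∧
      (∀ x y z : A, AkivisAlgebra.ι e (AkivisAlgebra.tri (k := k) x y z) =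
        (AkivisAlgebra.ι e x * AkivisAlgebra.ι e y) * AkivisAlgebra.ι e z -
          AkivisAlgebra.ι e x * (AkivisAlgebra.ι e y * AkivisAlgebra.ι e z))) := by
  exact ⟨⟨AkivisAlgebra.isGroebnerShirshovBasis_gsSet e, AkivisAlgebra.idealSpan_gsSet e⟩,
    AkivisAlgebra.ι_injective e, AkivisAlgebra.ι_br e, AkivisAlgebra.ι_tri e⟩
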